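/- **Setting.** Let $\mathcal X,\mathcal Y,\mathcal Z,\widetilde{\mathcal Z}$ be finite-dimensional real Hilbert spaces, $A:\mathcal X\to\mathcal Y$, $\mathfrak L:\mathcal X\to\mathcal Z$, $B:\mathcal Z\to\widetilde{\mathcal Z}$ linear, $y\in\mathcal Y$ and $\mu>0$. Let $\Psi:\mathcal Z\to\mathbb R$ be convex, lower semicontinuous, coercive ($\Psi(z)\to\infty$ as $\|z\|\to\infty$) and even ($\Psi(-z)=\Psi(z)$), and assume $A^*A-\mu\mathfrak L^*B^*B\mathfrak L\succeq 0$. Put $$\Psi_B(z):=\Psi(z)-\min_{v\in\mathcal Z}\Big[\Psi(v)+\tfrac12\|B(z-v)\|^2\Big],\qquad J(x):=\tfrac12\|y-Ax\|^2+\mu\,\Psi_B(\mathfrak Lx),\qquad \mathcal S:=\operatorname*{argmin}_{x\in\mathcal X}J(x).$$ Let $\Psi^*(u)=\sup_{x}\{\langle x,u\rangle-\Psi(x)\}$ be the conjugate of $\Psi$ and $\operatorname{prox}_f(x)$ the minimizer of $f+\frac12\|x-\cdot\|^2$. Let $\mathcal H:=\mathcal X\times\mathcal Z\times\mathcal Z$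 carry the sum of the inner products of its factors. For $\sigma,\tau>0$ define $T_{\rm LiGME}:\mathcal H\to\mathcal H$, $(x,v,w)\mapsto(\xi,\zeta,\eta)$ by $$\begin{aligned} \xi&:=\Big[\mathrm{Id}-\tfrac1\sigma(A^*A-\mu\mathfrak L^*B^*B\mathfrak L)\Big]x-\tfrac\mu\sigma\mathfrak L^*B^*Bv-\tfrac\mu\sigma\mathfrak L^*w+\tfrac1\sigma A^*y,\\ \zeta&:=\operatorname{prox}_{\frac\mu\tau\Psi}\Big[\tfrac{2\mu}\tau B^*B\mathfrak L\xi-\tfrac\mu\tau B^*B\mathfrak Lx+\big(\mathrm{Id}-\tfrac\mu\tau B^*B\big)v\Big],\\ \eta&:=\operatorname{prox}_{\Psi^*}(2\mathfrak L\xi-\mathfrak Lx+w). \end{aligned}$$ **Theorem 1.** The minimum in $\Psi_B$ is attained for every $z$, both proximity operators are well defined and single-valued on $\mathcal Z$, and: (a) $\mathcal S=\{x^\star : (x^\star,v^\star,w^\star)\in\mathrm{Fix}(T_{\rm LiGME})\text{ for some } v^\star,w^\star\in\mathcal Z\}$. (b) If $\kappa>1$ and $(\sigma,\tau,\kappa)$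 satisfies $$\sigma\,\mathrm{Id}-\tfrac\kappa2A^*A-\mu\mathfrak L^*\mathfrak L\succ0,\qquad \tau\ge\Big(\tfrac\kappa2+\tfrac2\kappa\Big)\mu\|B\|_{\rm op}^2,\tag{1}$$ then $$\mathfrak P:=\begin{bmatrix}\sigma\,\mathrm{Id}&-\mu\mathfrak L^*B^*B&-\mu\mathfrak L^*\\-\mu B^*B\mathfrak L&\tau\,\mathrm{Id}&0\\-\mu\mathfrak L&0&\mu\,\mathrm{Id}\end{bmatrix}\succ0,$$ and $T_{\rm LiGME}$ is $\frac{\kappa}{2\kappa-1}$-averaged nonexpansive for the norm $\|u\|_{\mathfrak P}=\sqrt{\langle u,\mathfrak Pu\rangle}$; that is, $T_{\rm LiGME}=(1-\alpha)\mathrm{Id}+\alpha N$ with $\alpha=\frac{\kappa}{2\kappa-1}\in(0,1)$ and both $T_{\rm LiGME}$ and $N$ are $1$-Lipschitz for $\|\cdot\|_{\mathfrak P}$. For example, for every $\kappa>1$, condition (1) holds with $\sigma=\|\frac\kappa2A^*A+\mu\mathfrak L^*\mathfrak L\|_{\rm op}+(\kappa-1)$ and $\tau=(\frac\kappa2+\frac2\kappa)\mu\|B\|_{\rm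 op}^2+(\kappa-1)$. (c) If $\kappa>1$ and $(\sigma,\tau,\kappa)$ satisfies (1), then for every initial point $u_0\in\mathcal H$ the sequence $u_{k+1}=T_{\rm LiGME}(u_k)$, $u_k=(x_k,v_k,w_k)$, converges to some $(x^\star,v^\star,w^\star)\in\mathrm{Fix}(T_{\rm LiGME})$, and $\lim_{k\to\infty}x_k=x^\star\in\mathcal S$. -/

import Mathlib

open Set Filter Topology
open scoped InnerProductSpace

noncomputable section

namespace LiGME

section Convex

variable {H : Type*} [NormedAddCommGroup H] [InnerProductSpace ℝ H]

/-- The Legendre-Fenchel conjugate `f* (u) = sup_x (⟨x, u⟩ - f x)`. -/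
def conj (f : H → EReal) (u : H) : EReal :=
  ⨆ x : H, (((⟪x, u⟫_ℝ : ℝ) : EReal) - f x)

/-- `p` minimizes `y ↦ f y + ½ ‖x - y‖²`. -/
def IsProx (f : H → EReal) (x p : H) : Prop :=
  ∀ y : H, f p + ((1 / 2 * ‖x - p‖ ^ 2 : ℝ) : EReal) ≤ f y + ((1 / 2 * ‖x - y‖ ^ 2 : ℝ) : EReal)

open Classical in
/-- The proximity operator: the minimizer of `y ↦ f y + ½ ‖x - y‖²` (and `0` if there is none). -/
def prox (f : H → EReal) (x : H) : H :=
  if h : ∃ p, IsProx f x p then h.choose else 0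

/-- `P ≻ 0`: `P` is self-adjoint and positive definite. -/
def PosDef (P : H →L[ℝ] H) : Prop :=
  (P : H →ₗ[ℝ] H).IsSymmetric ∧ ∀ u : H, u ≠ 0 → 0 < ⟪u, P u⟫_ℝ

/-- The norm `‖u‖_P = √⟨u, P u⟩`. -/
def normP (P : H →L[ℝ] H) (u : H) : ℝ := √⟪u, P u⟫_ℝ

/-- `T` is nonexpansive for `‖·‖_P`. -/
def NonexpansiveIn (P : H →L[ℝ] H) (T : H → H) : Prop :=
  ∀ u u' : H, normP P (T u - T u') ≤ normP P (u - u')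

/-- `T` is an `α`-averaged nonexpansive operator for `‖·‖_P`. -/
def AveragedIn (P : H →L[ℝ] H) (α : ℝ) (T : H → H) : Prop :=
  α ∈ Ioo (0 : ℝ) 1 ∧ NonexpansiveIn P T ∧
    ∃ N : H → H, NonexpansiveIn P N ∧ ∀ u : H, T u = (1 - α) • u + α • N u

end Convex

/-- The Hilbert space `𝒳 × 𝒵 × 𝒵`, whose inner product is the sum of those of the factors. -/
abbrev Space (X Z : Type*) := WithLp 2 (X × WithLp 2 (Z × Z))

/-- The triple `(x, v, w)` as a point of `𝒳 × 𝒵 × 𝒵`. -/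
abbrev triple {X Z : Type*} (x : X) (v w : Z) : Space X Z :=
  WithLp.toLp 2 (x, WithLp.toLp 2 (v, w))

section Model

variable {X Y Z Z' : Type*}
  [NormedAddCommGroup X] [InnerProductSpace ℝ X] [CompleteSpace X]
  [NormedAddCommGroup Y] [InnerProductSpace ℝ Y] [CompleteSpace Y]
  [NormedAddCommGroup Z] [InnerProductSpace ℝ Z] [CompleteSpace Z]
  [NormedAddCommGroup Z'] [InnerProductSpace ℝ Z'] [CompleteSpace Z']

/-- The GME penalty `Ψ_B (z) = Ψ z - min_v (Ψ v + ½ ‖B (z - v)‖²)`. -/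
def gme (Ψ : Z → ℝ) (B : Z →L[ℝ] Z') (z : Z) : ℝ :=
  Ψ z - ⨅ v : Z, (Ψ v + 1 / 2 * ‖B (z - v)‖ ^ 2)

/-- The LiGME cost `J (x) = ½ ‖y - A x‖² + μ Ψ_B (L x)`. -/
def cost (Ψ : Z → ℝ) (A : X →L[ℝ] Y) (L : X →L[ℝ] Z) (B : Z →L[ℝ] Z') (y : Y) (μ : ℝ)
    (x : X) : ℝ :=
  1 / 2 * ‖y - A x‖ ^ 2 + μ * gme Ψ B (L x)

/-- The set of global minimizers of the LiGME cost. -/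
def solutions (Ψ : Z → ℝ) (A : X →L[ℝ] Y) (L : X →L[ℝ] Z) (B : Z →L[ℝ] Z') (y : Y) (μ : ℝ) :
    Set X :=
  {x | ∀ x' : X, cost Ψ A L B y μ x ≤ cost Ψ A L B y μ x'}

/-- The operator `T_LiGME : (x, v, w) ↦ (ξ, ζ, η)`. -/
def T (Ψ : Z → ℝ) (A : X →L[ℝ] Y) (L : X →L[ℝ] Z) (B : Z →L[ℝ] Z') (y : Y) (μ σ τ : ℝ)
    (u : Space X Z) : Space X Z :=
  let x : X := u.fst
  let v : Z := u.snd.fst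
  let w : Z := u.snd.snd
  let BB : Z →L[ℝ] Z := B.adjoint ∘L B
  let ξ : X := x - (1 / σ) • (A.adjoint (A x) - μ • L.adjoint (BB (L x)))
    - (μ / σ) • L.adjoint (BB v) - (μ / σ) • L.adjoint w + (1 / σ) • A.adjoint y
  let ζ : Z := prox (fun z => ((μ / τ * Ψ z : ℝ) : EReal))
    ((2 * μ / τ) • BB (L ξ) - (μ / τ) • BB (L x) + (v - (μ / τ) • BB v))
  let η : Z := prox (conj fun z => (Ψ z : EReal)) ((2 : ℝ) • L ξ - L x + w)
  triple ξ ζ η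

/-- The block operator
`[σ Id, -μ L*B*B, -μ L*; -μ B*B L, τ Id, 0; -μ L, 0, μ Id]`. -/
def blockP (L : X →L[ℝ] Z) (B : Z →L[ℝ] Z') (μ σ τ : ℝ) : Space X Z →L[ℝ] Space X Z where
  toFun u := triple
    (σ • u.fst - μ • L.adjoint (B.adjoint (B u.snd.fst)) - μ • L.adjoint u.snd.snd)
    (-(μ • B.adjoint (B (L u.fst))) + τ • u.snd.fst)
    (-(μ • L u.fst) + μ • u.snd.snd)
  map_add' u u' := by
    simp only [WithLp.add_fst, WithLp.add_snd, map_add, smul_add, triple, ← WithLp.toLp_add,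
      Prod.mk_add_mk]
    congr 2
    · abel
    · congr 2 <;> abel
  map_smul' c u := by
    simp only [WithLp.smul_fst, WithLp.smul_snd, map_smul, triple, ← WithLp.toLp_smul,
      Prod.smul_mk, RingHom.id_apply, smul_sub, smul_add, smul_neg, smul_comm c]
  cont := by
    unfold triple
    fun_prop

/-- The step-size condition: `σ Id - (κ/2) A*A - μ L*L ≻ 0` and `τ ≥ (κ/2 + 2/κ) μ ‖B‖²`. -/
def StepSize (A : X →L[ℝ] Y) (L : X →L[ℝ] Z) (B : Z →L[ℝ] Z') (μ σ τ κ : ℝ) : Prop :=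
  PosDef (σ • ContinuousLinearMap.id ℝ X - (κ / 2) • (A.adjoint ∘L A) - μ • (L.adjoint ∘L L)) ∧
    (κ / 2 + 2 / κ) * μ * ‖B‖ ^ 2 ≤ τ

end Model

end LiGME

end

open Set Filter Topology
open scoped InnerProductSpace

noncomputable section

namespace LiGME

/-! ### Subgradients of finite convex functions and Fermat's rule. -/

section Subgradient

variable {E F : Type*} [NormedAddCommGroup E] [InnerProductSpace ℝ E]
  [NormedAddCommGroup F] [InnerProductSpace ℝ F]

/-! Writing the inner minimum as a maximum of its negative exhibits `J` as a supremum over `v` of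
functions of `x`, each convex because `A*A - μ L*B*BL ⪰ 0`. Its optimality system is: `saddleGrad`
vanishes, `v` attains the inner minimum at `L x`, and `w ∈ ∂Ψ(L x)`. By Moreau's decomposition for
the prox of `Ψ*`, this is also the fixed-point equation of `T` (`mem_fixedPoints_T_iff`).

Sufficiency in (a) holds because a saddle gradient is a subgradient of `J` (`cost_add_inner_le`).
For necessity, the saddle gradients at a minimizer form a compact convex set that meets the
half-space `⟪·, d⟫ ≥ 0` for every `d` (`exists_isSubgrad_inner_nonneg`); projection then shows that
it contains `0`.

For (b), `T` is a forward-backward step in the metric `P = blockP`. The forward part is the gradient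
of half the form `Q(u) = ‖Ax‖² - μ‖BLx‖² + μ‖Bv‖² ≥ 0`, up to a constant, and the step sizes give
`(κ/2) Q ≤ ⟪·, P ·⟫`. With `D = Tu - Tu'` and `e = (u - u') - D`, monotonicity yields `⟪D, Pe⟫ ≥ Q(D
+ e/2) - Q(e)/4 ≥ -⟪e, Pe⟫/(2κ)`, which is averagedness.

Part (c) is the Krasnosel'skii-Mann argument in the `P`-norm. A fixed point exists because `J` has a
minimizer (`solutions_nonempty`). -/

/-- `w` is a subgradient of `f` at `z`. -/
def IsSubgrad (f : E → ℝ) (z w : E) : Prop :=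
  ∀ z' : E, f z + ⟪w, z' - z⟫_ℝ ≤ f z'

theorem IsSubgrad.monotone {f : E → ℝ} {z w z' w' : E} (h : IsSubgrad f z w)
    (h' : IsSubgrad f z' w') : 0 ≤ ⟪w - w', z - z'⟫_ℝ := by
  have h1 := h z'
  have h2 := h' z
  rw [inner_sub_left]
  rw [← neg_sub z z', inner_neg_right] at h1
  linarith

theorem IsSubgrad.smul {f : E → ℝ} {z w : E} (h : IsSubgrad f z w) {c : ℝ} (hc : 0 ≤ c) :
    IsSubgrad (fun x => c * f x) z (c • w) := by
  intro z'
  rw [real_inner_smul_left, ← mul_add]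
  exact mul_le_mul_of_nonneg_left (h z') hc

theorem isSubgrad_smul_iff {f : E → ℝ} {z w : E} {c : ℝ} (hc : 0 < c) :
    IsSubgrad (fun x => c * f x) z w ↔ IsSubgrad f z (c⁻¹ • w) := by
  constructor
  · intro h
    simpa [← mul_assoc, inv_mul_cancel₀ hc.ne'] using h.smul (inv_nonneg.2 hc.le)
  · intro h
    simpa [smul_smul, mul_inv_cancel₀ hc.ne'] using h.smul hc.le

theorem isClosed_setOf_isSubgrad (f : E → ℝ) (hf : Continuous f) :
    IsClosed {p : E × E | IsSubgrad f p.1 p.2} := by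
  simp only [IsSubgrad, ofPred_forall]
  exact isClosed_iInter fun z' => isClosed_le (by fun_prop) (by fun_prop)

theorem convex_setOf_isSubgrad (f : E → ℝ) (z : E) : Convex ℝ {w | IsSubgrad f z w} := by
  intro w hw w' hw' a b ha hb hab z'
  have h1 := mul_le_mul_of_nonneg_left (hw z') ha
  have h2 := mul_le_mul_of_nonneg_left (hw' z') hb
  rw [inner_add_left, real_inner_smul_left, real_inner_smul_left]
  have : b = 1 - a := by linarith
  subst this
  linarith

/-- A function with a subgradient at every point is convex. -/
theorem convexOn_of_forall_exists_isSubgrad {f : E → ℝ} (h : ∀ z, ∃ w, IsSubgrad f z w) :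
    ConvexOn ℝ univ f := by
  refine ⟨convex_univ, fun x _ y _ a b ha hb hab => ?_⟩
  obtain ⟨w, hw⟩ := h (a • x + b • y)
  have h1 := mul_le_mul_of_nonneg_left (hw x) ha
  have h2 := mul_le_mul_of_nonneg_left (hw y) hb
  have h3 : a * ⟪w, x - (a • x + b • y)⟫_ℝ + b * ⟪w, y - (a • x + b • y)⟫_ℝ = 0 := by
    have hb' : b = 1 - a := by linarith
    subst hb'
    simp only [inner_sub_right, inner_add_right, real_inner_smul_right]
    ring
  simp only [smul_eq_mul]
  have : a * f (a • x + b • y) + b * f (a • x + b • y) = f (a • x + b • y) := by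
    rw [← add_mul, hab, one_mul]
  linarith

/-- Hahn-Banach separates the graph point over `z` from the open strict epigraph. The separating
functional has positive vertical component `c`; dividing by `c` gives the slope. -/
theorem _root_.ConvexOn.exists_isSubgrad [CompleteSpace E] {f : E → ℝ}
    (hf : ConvexOn ℝ univ f) (hc : Continuous f) (z : E) : ∃ w, IsSubgrad f z w := by
  have hconv := hf.convex_strict_epigraph
  have hopen : IsOpen {p : E × ℝ | p.1 ∈ univ ∧ f p.1 < p.2} := by
    simp only [mem_univ, true_and]
    exact isOpen_lt (by fun_prop) (by fun_prop)
  obtain ⟨g, hg⟩ := geometric_hahn_banach_point_open (x := (z, f z)) hconv hopen (by simp)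
  have hsplit : ∀ (x : E) (r : ℝ), g (x, r) = g (x, 0) + r * g (0, 1) := by
    intro x r
    have : (x, r) = (x, (0 : ℝ)) + r • ((0 : E), (1 : ℝ)) := by simp
    rw [this, map_add, map_smul, smul_eq_mul]
  set c := g (0, 1)
  have hcpos : 0 < c := by
    have := hg (z, f z + 1) (by simp)
    rw [hsplit z (f z), hsplit z (f z + 1)] at this
    linarith
  let l : E →L[ℝ] ℝ := g.comp (ContinuousLinearMap.inl ℝ E ℝ)
  have hle : ∀ x, l z + f z * c ≤ l x + f x * c := by
    intro x
    refine le_of_forall_pos_le_add fun ε hε => ?_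
    have := hg (x, f x + ε / c) (by simp; positivity)
    rw [hsplit z (f z), hsplit x] at this
    have e : ε / c * c = ε := div_mul_cancel₀ _ hcpos.ne'
    change g (z, 0) + f z * c ≤ g (x, 0) + f x * c + ε
    linarith
  refine ⟨-(c⁻¹ • (InnerProductSpace.toDual ℝ E).symm l), fun x => ?_⟩
  rw [inner_neg_left, real_inner_smul_left, InnerProductSpace.toDual_symm_apply, map_sub]
  have h1 := mul_le_mul_of_nonneg_left (hle x) (inv_nonneg.2 hcpos.le)
  have h2 : ∀ x, c⁻¹ * (l x + f x * c) = c⁻¹ * l x + f x := by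
    intro x; field_simp
  rw [h2, h2] at h1
  linarith

/-- Subgradients at points of a bounded set are bounded. -/
theorem exists_forall_isSubgrad_norm_le [ProperSpace E] {f : E → ℝ} (hc : Continuous f) (R : ℝ) :
    ∃ M, ∀ z w, ‖z‖ ≤ R → IsSubgrad f z w → ‖w‖ ≤ M := by
  obtain ⟨C, hC⟩ := (isCompact_closedBall (0 : E) (R + 1)).exists_bound_of_continuousOn
    hc.continuousOn
  refine ⟨max 0 (C + C), fun z w hz hw => ?_⟩
  rcases eq_or_ne w 0 with rfl | hw0
  · simp
  have hn : 0 < ‖w‖ := norm_pos_iff.2 hw0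
  -- A unit step along `w` raises `f` by at least `‖w‖`, while `f` is bounded on the ball of radius
  -- `R + 1`.
  have h1 := hw (z + ‖w‖⁻¹ • w)
  rw [add_sub_cancel_left, real_inner_smul_right, real_inner_self_eq_norm_sq] at h1
  have h2 : ‖w‖⁻¹ * ‖w‖ ^ 2 = ‖w‖ := by field_simp
  have hu : ‖‖w‖⁻¹ • w‖ = 1 := by
    rw [norm_smul, norm_inv, norm_norm, inv_mul_cancel₀ hn.ne']
  have h3 := hC (z + ‖w‖⁻¹ • w) (by
    rw [mem_closedBall_zero_iff]
    linarith [norm_add_le z (‖w‖⁻¹ • w)])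
  have h4 := hC z (by rw [mem_closedBall_zero_iff]; linarith)
  rw [Real.norm_eq_abs, abs_le] at h3 h4
  exact le_max_of_le_right (by linarith)

theorem nonneg_of_forall_add_mul_nonneg {a c : ℝ} (h : ∀ t : ℝ, 0 < t → t ≤ 1 → 0 ≤ a + t * c) :
    0 ≤ a := by
  have ht : Tendsto (fun t : ℝ => a + t * c) (𝓝[>] 0) (𝓝 a) := by
    have : Continuous fun t : ℝ => a + t * c := by fun_prop
    simpa using (this.tendsto 0).mono_left nhdsWithin_le_nhds
  refine ge_of_tendsto ht ?_
  filter_upwards [Ioc_mem_nhdsGT (zero_lt_one' ℝ)] with t ht using h t ht.1 ht.2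

theorem half_norm_sub_sq (a b : E) :
    1 / 2 * ‖a - b‖ ^ 2 = 1 / 2 * ‖a‖ ^ 2 - ⟪a, b⟫_ℝ + 1 / 2 * ‖b‖ ^ 2 := by
  rw [norm_sub_sq_real]; ring

/-- Fermat's rule for the sum of a convex function and a least-squares term. -/
theorem forall_add_norm_sq_le_iff_isSubgrad [CompleteSpace E] [CompleteSpace F] {f : E → ℝ}
    (hf : ConvexOn ℝ univ f) (B : E →L[ℝ] F) (z v : E) :
    (∀ v', f v + 1 / 2 * ‖B (z - v)‖ ^ 2 ≤ f v' + 1 / 2 * ‖B (z - v')‖ ^ 2) ↔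
      IsSubgrad f v (B.adjoint (B (z - v))) := by
  have key : ∀ δ : E, 1 / 2 * ‖B (z - (v + δ))‖ ^ 2 = 1 / 2 * ‖B (z - v)‖ ^ 2
      - ⟪B.adjoint (B (z - v)), δ⟫_ℝ + 1 / 2 * ‖B δ‖ ^ 2 := by
    intro δ
    rw [ContinuousLinearMap.adjoint_inner_left, ← half_norm_sub_sq, ← map_sub, sub_sub]
  constructor
  · intro h v'
    suffices 0 ≤ f v' - f v - ⟪B.adjoint (B (z - v)), v' - v⟫_ℝ by linarith
    -- Minimality is tested on the segment from `v` to `v'`: the quadratic term is of order `t²`, so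
    -- it vanishes after dividing by `t` and letting `t → 0`.
    refine nonneg_of_forall_add_mul_nonneg (c := 1 / 2 * ‖B (v' - v)‖ ^ 2) fun t ht ht1 => ?_
    have h1 := h (v + t • (v' - v))
    rw [key, real_inner_smul_right, map_smul, norm_smul, mul_pow, Real.norm_eq_abs, sq_abs] at h1
    have h2 := hf.2 (mem_univ v) (mem_univ v') (sub_nonneg.2 ht1) ht.le (by ring)
    have e : (1 - t) • v + t • v' = v + t • (v' - v) := by
      rw [sub_smul, smul_sub, one_smul]; abel
    rw [e, smul_eq_mul, smul_eq_mul] at h2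
    have h3 : 0 ≤ t * (f v' - f v - ⟪B.adjoint (B (z - v)), v' - v⟫_ℝ
        + t * (1 / 2 * ‖B (v' - v)‖ ^ 2)) := by
      nlinarith
    exact nonneg_of_mul_nonneg_right h3 ht
  · intro h v'
    have h1 := h v'
    have h2 := key (v' - v)
    rw [add_sub_cancel] at h2
    have := sq_nonneg ‖B (v' - v)‖
    linarith

theorem exists_forall_add_norm_sq_le [ProperSpace E] {f : E → ℝ} (hc : Continuous f)
    (hcoer : Tendsto f (Bornology.cobounded E) atTop) (B : E →L[ℝ] F) (z : E) :
    ∃ v, ∀ v', f v + 1 / 2 * ‖B (z - v)‖ ^ 2 ≤ f v' + 1 / 2 * ‖B (z - v')‖ ^ 2 := by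
  have hcont : Continuous fun v' => f v' + 1 / 2 * ‖B (z - v')‖ ^ 2 := by fun_prop
  refine hcont.exists_forall_le ?_
  rw [← Metric.cobounded_eq_cocompact]
  exact tendsto_atTop_mono (fun v => le_add_of_nonneg_right (by positivity)) hcoer

end Subgradient

/-! ### Proximity operators of `Ψ` and of its conjugate. -/

section Prox

variable {E : Type*} [NormedAddCommGroup E]

theorem prox_spec {f : E → EReal} {x : E} (h : ∃ p, IsProx f x p) : IsProx f x (prox f x) := by
  rw [prox, dif_pos h]
  exact h.choose_spec

variable [InnerProductSpace ℝ E]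

theorem isProx_coe_iff [CompleteSpace E] {f : E → ℝ} (hf : ConvexOn ℝ univ f) (x p : E) :
    IsProx (fun z => (f z : EReal)) x p ↔ IsSubgrad f p (x - p) := by
  have := forall_add_norm_sq_le_iff_isSubgrad hf (ContinuousLinearMap.id ℝ E) x p
  simp only [ContinuousLinearMap.adjoint_id, ContinuousLinearMap.id_apply] at this
  rw [← this, IsProx]
  refine forall_congr' fun v' => ?_
  norm_cast

theorem isProx_coe_unique [CompleteSpace E] {f : E → ℝ} (hf : ConvexOn ℝ univ f) {x p q : E}
    (hp : IsProx (fun z => (f z : EReal)) x p) (hq : IsProx (fun z => (f z : EReal)) x q) :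
    p = q := by
  rw [isProx_coe_iff hf] at hp hq
  have h := hp.monotone hq
  rw [show x - p - (x - q) = -(p - q) by abel, inner_neg_left, real_inner_self_eq_norm_sq] at h
  have : ‖p - q‖ = 0 := by nlinarith [norm_nonneg (p - q)]
  exact sub_eq_zero.1 (norm_eq_zero.1 this)

theorem exists_isProx_coe [ProperSpace E] {f : E → ℝ} (hc : Continuous f)
    (hcoer : Tendsto f (Bornology.cobounded E) atTop) (x : E) :
    ∃ p, IsProx (fun z => (f z : EReal)) x p := by
  obtain ⟨v, hv⟩ := exists_forall_add_norm_sq_le hc hcoer (ContinuousLinearMap.id ℝ E) x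
  refine ⟨v, fun v' => ?_⟩
  have := hv v'
  simp only [ContinuousLinearMap.id_apply] at this
  beta_reduce
  exact_mod_cast this

theorem prox_coe_eq_iff [CompleteSpace E] [ProperSpace E] {f : E → ℝ} (hf : ConvexOn ℝ univ f)
    (hc : Continuous f) (hcoer : Tendsto f (Bornology.cobounded E) atTop) (x p : E) :
    prox (fun z => (f z : EReal)) x = p ↔ IsSubgrad f p (x - p) := by
  have hs := prox_spec (exists_isProx_coe hc hcoer x)
  rw [← isProx_coe_iff hf]
  constructor
  · rintro rfl; exact hs
  · exact fun h => isProx_coe_unique hf hs h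

theorem le_conj_coe (f : E → ℝ) (q w : E) :
    ((⟪q, w⟫_ℝ - f q : ℝ) : EReal) ≤ conj (fun z => (f z : EReal)) w := by
  rw [EReal.coe_sub]
  exact le_iSup (fun x : E => ((⟪x, w⟫_ℝ : ℝ) : EReal) - (f x : EReal)) q

theorem IsSubgrad.conj_coe_eq {f : E → ℝ} {q w : E} (h : IsSubgrad f q w) :
    conj (fun z => (f z : EReal)) w = ((⟪q, w⟫_ℝ - f q : ℝ) : EReal) := by
  refine le_antisymm (iSup_le fun x => ?_) (le_conj_coe f q w)
  have := h x
  rw [inner_sub_right, real_inner_comm x w, real_inner_comm q w] at this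
  rw [← EReal.coe_sub]
  exact_mod_cast (by linarith : ⟪x, w⟫_ℝ - f x ≤ ⟪q, w⟫_ℝ - f q)

/-- Moreau's decomposition: a strict minimality estimate for the prox of the conjugate. -/
theorem IsSubgrad.conj_add_norm_sq_le {f : E → ℝ} {r w : E} (h : IsSubgrad f (r - w) w) (w' : E) :
    conj (fun z => (f z : EReal)) w + ((1 / 2 * ‖r - w‖ ^ 2 + 1 / 2 * ‖w' - w‖ ^ 2 : ℝ) : EReal) ≤
      conj (fun z => (f z : EReal)) w' + ((1 / 2 * ‖r - w'‖ ^ 2 : ℝ) : EReal) := by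
  refine le_trans ?_ (add_le_add_left (le_conj_coe f (r - w) w') _)
  rw [h.conj_coe_eq]
  have := half_norm_sub_sq (r - w) (w' - w)
  rw [sub_sub_sub_cancel_right, inner_sub_right] at this
  exact_mod_cast (by linarith : ⟪r - w, w⟫_ℝ - f (r - w) +
    (1 / 2 * ‖r - w‖ ^ 2 + 1 / 2 * ‖w' - w‖ ^ 2) ≤ ⟪r - w, w'⟫_ℝ - f (r - w) + 1 / 2 * ‖r - w'‖ ^ 2)

theorem IsSubgrad.isProx_conj {f : E → ℝ} {r w : E} (h : IsSubgrad f (r - w) w) :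
    IsProx (conj fun z => (f z : EReal)) r w := by
  intro w'
  refine le_trans (add_le_add_right ?_ _) (h.conj_add_norm_sq_le w')
  exact_mod_cast le_add_of_nonneg_right (by positivity)

theorem IsSubgrad.isProx_conj_unique {f : E → ℝ} {r w w' : E} (h : IsSubgrad f (r - w) w)
    (h' : IsProx (conj fun z => (f z : EReal)) r w') : w' = w := by
  have h1 := (h.conj_add_norm_sq_le w').trans (h' w)
  rw [h.conj_coe_eq] at h1
  have h2 : ⟪r - w, w⟫_ℝ - f (r - w) + (1 / 2 * ‖r - w‖ ^ 2 + 1 / 2 * ‖w' - w‖ ^ 2) ≤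
      ⟪r - w, w⟫_ℝ - f (r - w) + 1 / 2 * ‖r - w‖ ^ 2 := by exact_mod_cast h1
  have : ‖w' - w‖ = 0 := by nlinarith [norm_nonneg (w' - w)]
  exact sub_eq_zero.1 (norm_eq_zero.1 this)

theorem exists_isSubgrad_sub_self [CompleteSpace E] [ProperSpace E] {f : E → ℝ}
    (hf : ConvexOn ℝ univ f) (hc : Continuous f)
    (hcoer : Tendsto f (Bornology.cobounded E) atTop) (r : E) :
    ∃ w, IsSubgrad f (r - w) w := by
  obtain ⟨p, hp⟩ := exists_isProx_coe hc hcoer r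
  rw [isProx_coe_iff hf] at hp
  exact ⟨r - p, by rwa [sub_sub_cancel]⟩

/-- Existence comes from `r - prox f r`, and uniqueness from the quadratic gain in
`conj_add_norm_sq_le`. The extended-valued conjugate is thus handled entirely through subgradients
of the finite `f`. -/
theorem prox_conj_eq_iff [CompleteSpace E] [ProperSpace E] {f : E → ℝ} (hf : ConvexOn ℝ univ f)
    (hc : Continuous f) (hcoer : Tendsto f (Bornology.cobounded E) atTop) (r w : E) :
    prox (conj fun z => (f z : EReal)) r = w ↔ IsSubgrad f (r - w) w := by
  obtain ⟨p, hp⟩ := exists_isSubgrad_sub_self hf hc hcoer r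
  have hs := hp.isProx_conj_unique (prox_spec ⟨p, hp.isProx_conj⟩)
  constructor
  · rintro rfl; rwa [hs]
  · exact fun h => h.isProx_conj_unique (prox_spec ⟨p, hp.isProx_conj⟩)

end Prox

/-! ### Averaged operators and fixed-point iteration in the metric of `P`. -/

section Metric

variable {E : Type*} [NormedAddCommGroup E] [InnerProductSpace ℝ E]

theorem PosDef.inner_self_nonneg {P : E →L[ℝ] E} (hP : PosDef P) (u : E) : 0 ≤ ⟪u, P u⟫_ℝ := by
  rcases eq_or_ne u 0 with rfl | hu
  · simp
  · exact (hP.2 u hu).le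

theorem PosDef.inner_symm {P : E →L[ℝ] E} (hP : PosDef P) (u v : E) :
    ⟪u, P v⟫_ℝ = ⟪v, P u⟫_ℝ := by
  rw [real_inner_comm]
  exact hP.1 v u

/-- The quadratic form attains a positive minimum on the compact unit sphere. Convergence in the
`P`-norm therefore implies ordinary convergence. -/
theorem PosDef.exists_mul_norm_sq_le [FiniteDimensional ℝ E] {P : E →L[ℝ] E} (hP : PosDef P) :
    ∃ m > 0, ∀ u, m * ‖u‖ ^ 2 ≤ ⟪u, P u⟫_ℝ := by
  rcases subsingleton_or_nontrivial E with _ | _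
  · exact ⟨1, one_pos, fun u => by simp [Subsingleton.elim u 0]⟩
  obtain ⟨u₀, hu₀, hmin⟩ := (isCompact_sphere (0 : E) 1).exists_isMinOn
    (NormedSpace.sphere_nonempty.2 zero_le_one)
    (f := fun u => ⟪u, P u⟫_ℝ) (by fun_prop)
  have hu₀' : u₀ ≠ 0 := by
    rintro rfl
    simp at hu₀
  refine ⟨_, hP.2 u₀ hu₀', fun u => ?_⟩
  rcases eq_or_ne u 0 with rfl | hu
  · simp
  have hn : 0 < ‖u‖ := norm_pos_iff.2 hu
  have h1 : ⟪u₀, P u₀⟫_ℝ ≤ ⟪‖u‖⁻¹ • u, P (‖u‖⁻¹ • u)⟫_ℝ := hmin (by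
    rw [mem_sphere_zero_iff_norm, norm_smul, norm_inv, norm_norm, inv_mul_cancel₀ hn.ne'])
  rw [map_smul, real_inner_smul_left, real_inner_smul_right] at h1
  calc ⟪u₀, P u₀⟫_ℝ * ‖u‖ ^ 2 ≤ ‖u‖⁻¹ * (‖u‖⁻¹ * ⟪u, P u⟫_ℝ) * ‖u‖ ^ 2 := by gcongr
    _ = ⟪u, P u⟫_ℝ := by field_simp

theorem nonexpansiveIn_of_inner_le {P : E →L[ℝ] E} {T : E → E}
    (h : ∀ u u', ⟪T u - T u', P (T u - T u')⟫_ℝ ≤ ⟪u - u', P (u - u')⟫_ℝ) :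
    NonexpansiveIn P T :=
  fun u u' => Real.sqrt_le_sqrt (h u u')

/-- The quadratic characterization of averaged operators. -/
theorem averagedIn_of_inner_le {P : E →L[ℝ] E} (hP : PosDef P) {T : E → E} {α : ℝ}
    (hα : α ∈ Ioo (0 : ℝ) 1)
    (h : ∀ u u', ⟪T u - T u', P (T u - T u')⟫_ℝ + (1 - α) / α *
      ⟪(u - u') - (T u - T u'), P ((u - u') - (T u - T u'))⟫_ℝ ≤ ⟪u - u', P (u - u')⟫_ℝ) :
    AveragedIn P α T := by
  have hα0 := hα.1
  have hc : 0 ≤ (1 - α) / α := div_nonneg (by linarith [hα.2]) hα0.le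
  refine ⟨hα, nonexpansiveIn_of_inner_le fun u u' => ?_,
    fun u => u - α⁻¹ • (u - T u), nonexpansiveIn_of_inner_le fun u u' => ?_, fun u => ?_⟩
  · nlinarith [h u u', mul_nonneg hc (hP.inner_self_nonneg ((u - u') - (T u - T u')))]
  -- With `D = d - e`, both the hypothesis and `‖d - α⁻¹ e‖_P ≤ ‖d‖_P` reduce to `α⁻¹ ‖e‖_P² ≤ 2 ⟪d,
  -- P e⟫`.
  · have h1 := h u u'
    set d := u - u'
    set D := T u - T u'
    obtain ⟨e, he⟩ : ∃ e, e = d - D := ⟨_, rfl⟩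
    have hD : D = d - e := by rw [he]; abel
    have hN : u - α⁻¹ • (u - T u) - (u' - α⁻¹ • (u' - T u')) = d - α⁻¹ • e := by
      simp only [he, d, D, smul_sub]
      abel
    rw [hN]
    rw [← he, hD] at h1
    simp only [map_sub, map_smul, inner_sub_left, inner_sub_right, real_inner_smul_left,
      real_inner_smul_right] at h1 ⊢
    rw [hP.inner_symm e d] at h1 ⊢
    have e1 : (1 - α) / α = α⁻¹ - 1 := by field_simp
    rw [e1] at h1
    have h2 := mul_le_mul_of_nonneg_left h1 (inv_nonneg.2 hα0.le)
    linarith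
  · rw [smul_sub, smul_smul, mul_inv_cancel₀ hα0.ne']
    rw [sub_smul]
    simp

/-- Krasnosel'skii-Mann iteration in finite dimension. -/
theorem exists_tendsto_fixedPoint [FiniteDimensional ℝ E] {P : E →L[ℝ] E} (hP : PosDef P)
    {T : E → E} {c : ℝ} (hc : 0 < c)
    (h : ∀ u u', ⟪T u - T u', P (T u - T u')⟫_ℝ + c *
      ⟪(u - u') - (T u - T u'), P ((u - u') - (T u - T u'))⟫_ℝ ≤ ⟪u - u', P (u - u')⟫_ℝ)
    (hfix : (Function.fixedPoints T).Nonempty) (u : ℕ → E) (hu : ∀ k, u (k + 1) = T (u k)) :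
    ∃ p ∈ Function.fixedPoints T, Tendsto u atTop (𝓝 p) := by
  obtain ⟨m, hm, hmle⟩ := hP.exists_mul_norm_sq_le
  have hq : ∀ p ∈ Function.fixedPoints T, ∀ k,
      ⟪u (k + 1) - p, P (u (k + 1) - p)⟫_ℝ + c * ⟪u k - T (u k), P (u k - T (u k))⟫_ℝ ≤
        ⟪u k - p, P (u k - p)⟫_ℝ := by
    intro p hp k
    have h1 := h (u k) p
    rw [hp.eq, sub_sub_sub_cancel_right] at h1
    rwa [hu k]
  have hanti : ∀ p ∈ Function.fixedPoints T, Antitone fun k => ⟪u k - p, P (u k - p)⟫_ℝ :=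
    fun p hp => antitone_nat_of_succ_le fun k => by
      nlinarith [hq p hp k, mul_nonneg hc.le (hP.inner_self_nonneg (u k - T (u k)))]
  have hlim : ∀ p ∈ Function.fixedPoints T, ∃ l,
      Tendsto (fun k => ⟪u k - p, P (u k - p)⟫_ℝ) atTop (𝓝 l) := fun p hp =>
    ⟨_, tendsto_atTop_ciInf (hanti p hp) ⟨0, by
      rintro _ ⟨k, rfl⟩; exact hP.inner_self_nonneg _⟩⟩
  have htend0 : ∀ v : ℕ → E, Tendsto (fun k => ⟪v k, P (v k)⟫_ℝ) atTop (𝓝 0) →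
      Tendsto v atTop (𝓝 0) := by
    intro v hv
    rw [tendsto_zero_iff_norm_tendsto_zero]
    have h1 : Tendsto (fun k => ‖v k‖ ^ 2) atTop (𝓝 0) := by
      refine squeeze_zero (fun k => by positivity) (fun k => ?_) (by simpa using hv.const_mul m⁻¹)
      rw [inv_mul_eq_div, le_div_iff₀ hm, mul_comm]
      exact hmle _
    simpa using h1.sqrt
  have hTcont : Continuous T := by
    rw [continuous_iff_continuousAt]
    intro a
    rw [ContinuousAt, tendsto_iff_seq_tendsto]
    intro v hv
    have h1 := htend0 (fun k => T (v k) - T a) (by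
      refine squeeze_zero (fun k => hP.inner_self_nonneg _)
        (fun k => (le_add_of_nonneg_right (mul_nonneg hc.le (hP.inner_self_nonneg _))).trans
          (h (v k) a)) ?_
      have : Continuous fun x => ⟪x - a, P (x - a)⟫_ℝ := by fun_prop
      simpa [Function.comp_def] using (this.tendsto a).comp hv)
    simpa [Function.comp_def] using h1.add_const (T a)
  obtain ⟨p₀, hp₀⟩ := hfix
  -- Each squared residual, times `c`, is at most the drop of the convergent squared distance to
  -- `p₀`.
  have hres : Tendsto (fun k => u k - T (u k)) atTop (𝓝 0) := by
    obtain ⟨l, hl⟩ := hlim p₀ hp₀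
    refine htend0 _ (squeeze_zero (fun k => hP.inner_self_nonneg _) (fun k => ?_)
      (by simpa using (hl.sub (hl.comp (tendsto_add_atTop_nat 1))).const_mul c⁻¹))
    have := hq p₀ hp₀ k
    rw [inv_mul_eq_div, le_div_iff₀ hc]
    simp only [map_sub] at this ⊢
    linarith
  have hbdd : ∀ k, u k ∈ Metric.closedBall p₀ (√(⟪u 0 - p₀, P (u 0 - p₀)⟫_ℝ / m)) := by
    intro k
    rw [mem_closedBall_iff_norm]
    refine Real.le_sqrt_of_sq_le ?_
    rw [le_div_iff₀ hm, mul_comm]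
    exact (hmle _).trans (hanti p₀ hp₀ (Nat.zero_le k))
  obtain ⟨p, -, φ, hφ, hp⟩ := (isCompact_closedBall p₀ _).tendsto_subseq hbdd
  have hpfix : p ∈ Function.fixedPoints T := by
    have h1 : Tendsto (fun k => u (φ k) - T (u (φ k))) atTop (𝓝 (p - T p)) :=
      hp.sub ((hTcont.tendsto p).comp hp)
    have h2 := tendsto_nhds_unique h1 (hres.comp hφ.tendsto_atTop)
    exact (sub_eq_zero.1 h2).symm
  refine ⟨p, hpfix, ?_⟩
  obtain ⟨l, hl⟩ := hlim p hpfix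
  -- The distance to the cluster point `p` converges along the whole sequence, and tends to zero
  -- along `φ`.
  have hl0 : l = 0 := by
    refine tendsto_nhds_unique (hl.comp hφ.tendsto_atTop) ?_
    have : Continuous fun x => ⟪x - p, P (x - p)⟫_ℝ := by fun_prop
    simpa [Function.comp_def] using (this.tendsto p).comp hp
  rw [hl0] at hl
  simpa using (htend0 _ hl).add_const p

end Metric

/-! ### Step sizes and the block metric. -/

section StepSizes

variable {X Y Z Z' : Type*}
  [NormedAddCommGroup X] [InnerProductSpace ℝ X] [CompleteSpace X]
  [NormedAddCommGroup Y] [InnerProductSpace ℝ Y] [CompleteSpace Y]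
  [NormedAddCommGroup Z] [InnerProductSpace ℝ Z] [CompleteSpace Z]
  [NormedAddCommGroup Z'] [InnerProductSpace ℝ Z'] [CompleteSpace Z']
  {A : X →L[ℝ] Y} {L : X →L[ℝ] Z} {B : Z →L[ℝ] Z'} {μ σ τ κ : ℝ}

theorem mul_norm_sq_le_of_isPositive
    (hC : (A.adjoint ∘L A - μ • (L.adjoint ∘L B.adjoint ∘L B ∘L L)).IsPositive) (x : X) :
    μ * ‖B (L x)‖ ^ 2 ≤ ‖A x‖ ^ 2 := by
  have h := hC.inner_nonneg_right x
  simp only [sub_apply, smul_apply,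
    ContinuousLinearMap.comp_apply, inner_sub_right, real_inner_smul_right,
    ContinuousLinearMap.adjoint_inner_right, real_inner_self_eq_norm_sq] at h
  linarith

theorem inner_blockP (u u' : Space X Z) :
    ⟪u, blockP L B μ σ τ u'⟫_ℝ = σ * ⟪u.fst, u'.fst⟫_ℝ - μ * ⟪B (L u.fst), B u'.snd.fst⟫_ℝ
      - μ * ⟪L u.fst, u'.snd.snd⟫_ℝ - μ * ⟪B u.snd.fst, B (L u'.fst)⟫_ℝ
      + τ * ⟪u.snd.fst, u'.snd.fst⟫_ℝ - μ * ⟪u.snd.snd, L u'.fst⟫_ℝ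
      + μ * ⟪u.snd.snd, u'.snd.snd⟫_ℝ := by
  have : blockP L B μ σ τ u' = triple
    (σ • u'.fst - μ • L.adjoint (B.adjoint (B u'.snd.fst)) - μ • L.adjoint u'.snd.snd)
    (-(μ • B.adjoint (B (L u'.fst))) + τ • u'.snd.fst)
    (-(μ • L u'.fst) + μ • u'.snd.snd) := rfl
  rw [this]
  simp only [WithLp.prod_inner_apply, inner_sub_right, inner_add_right, inner_neg_right,
    real_inner_smul_right, ContinuousLinearMap.adjoint_inner_right]
  simp only [WithLp.ofLp_fst, WithLp.ofLp_snd]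
  ring

/-- Completing squares: `μ‖Lx - w‖²` absorbs the coupling of `x` and `w`, and Young's inequality
with weight `κ/2` the coupling of `x` and `v`. In the bound on `τ`, `2/κ` pays for Young and `κ/2`
for the forward term in `Bv`. -/
theorem forward_add_le_inner_blockP (A : X →L[ℝ] Y) (L : X →L[ℝ] Z) (B : Z →L[ℝ] Z') (σ τ : ℝ)
    (hμ : 0 < μ) (hκ : 1 < κ) (u : Space X Z) :
    ⟪u.fst, (σ • ContinuousLinearMap.id ℝ X - (κ / 2) • (A.adjoint ∘L A)
        - μ • (L.adjoint ∘L L)) u.fst⟫_ℝ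
      + κ / 2 * (‖A u.fst‖ ^ 2 - μ * ‖B (L u.fst)‖ ^ 2 + μ * ‖B u.snd.fst‖ ^ 2)
      + μ * ‖L u.fst - u.snd.snd‖ ^ 2
      + (τ - (κ / 2 + 2 / κ) * μ * ‖B‖ ^ 2) * ‖u.snd.fst‖ ^ 2
      ≤ ⟪u, blockP L B μ σ τ u⟫_ℝ := by
  rw [inner_blockP]
  simp only [sub_apply, smul_apply,
    ContinuousLinearMap.comp_apply, inner_sub_right, real_inner_smul_right,
    ContinuousLinearMap.adjoint_inner_right, real_inner_self_eq_norm_sq,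
    ContinuousLinearMap.id_apply, norm_sub_sq_real]
  rw [real_inner_comm (L u.fst) u.snd.snd, real_inner_comm (B (L u.fst)) (B u.snd.fst)]
  have hκ0 : 0 < κ := by linarith
  have h1 : ‖B u.snd.fst‖ ^ 2 ≤ ‖B‖ ^ 2 * ‖u.snd.fst‖ ^ 2 := by
    rw [← mul_pow]
    gcongr
    exact B.le_opNorm _
  have h2 := mul_le_mul_of_nonneg_left h1
    (by positivity : 0 ≤ (κ / 2 + 2 / κ) * μ)
  have h3 := norm_sub_sq_real ((κ / 2) • B (L u.fst)) (B u.snd.fst)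
  rw [norm_smul, mul_pow, Real.norm_eq_abs, sq_abs, real_inner_smul_left] at h3
  have h4 : 0 ≤ 2 / κ * μ * ‖(κ / 2) • B (L u.fst) - B u.snd.fst‖ ^ 2 := by positivity
  rw [h3] at h4
  have h5 : 2 / κ * μ * ((κ / 2) ^ 2 * ‖B (L u.fst)‖ ^ 2
      - 2 * (κ / 2 * ⟪B (L u.fst), B u.snd.fst⟫_ℝ) + ‖B u.snd.fst‖ ^ 2) =
      κ / 2 * μ * ‖B (L u.fst)‖ ^ 2 - 2 * μ * ⟪B (L u.fst), B u.snd.fst⟫_ℝ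
        + 2 / κ * μ * ‖B u.snd.fst‖ ^ 2 := by
    field_simp
  rw [h5] at h4
  linarith

/-- The step sizes make `blockP` dominate the forward operator. -/
theorem StepSize.forward_le (hμ : 0 < μ) (hκ : 1 < κ)
    (h : StepSize A L B μ σ τ κ) (u : Space X Z) :
    κ / 2 * (‖A u.fst‖ ^ 2 - μ * ‖B (L u.fst)‖ ^ 2 + μ * ‖B u.snd.fst‖ ^ 2)
      ≤ ⟪u, blockP L B μ σ τ u⟫_ℝ := by
  have h1 := h.1.inner_self_nonneg u.fst
  have h2 : 0 ≤ μ * ‖L u.fst - u.snd.snd‖ ^ 2 := by positivity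
  have h3 := mul_nonneg (sub_nonneg.2 h.2) (sq_nonneg ‖u.snd.fst‖)
  linarith [forward_add_le_inner_blockP A L B σ τ hμ hκ u]

theorem StepSize.posDef_blockP (hμ : 0 < μ) (hτ : 0 < τ) (hκ : 1 < κ)
    (hC : (A.adjoint ∘L A - μ • (L.adjoint ∘L B.adjoint ∘L B ∘L L)).IsPositive)
    (h : StepSize A L B μ σ τ κ) : PosDef (blockP L B μ σ τ) := by
  constructor
  · intro u v
    change ⟪blockP L B μ σ τ u, v⟫_ℝ = ⟪u, blockP L B μ σ τ v⟫_ℝ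
    rw [real_inner_comm, inner_blockP, inner_blockP]
    simp only [real_inner_comm]
    ring
  · intro u hu
    -- For `x = 0` the form is `τ‖v‖² + μ‖w‖²`; otherwise the first summand of the lower bound is
    -- strictly positive.
    by_cases hx : u.fst = 0
    · rw [inner_blockP, hx]
      simp only [map_zero, inner_zero_left, inner_zero_right, real_inner_self_eq_norm_sq]
      by_cases hv : u.snd.fst = 0
      · have hw : u.snd.snd ≠ 0 := by
          intro hw
          refine hu ?_
          have : u = triple u.fst u.snd.fst u.snd.snd := rfl
          rw [this, hx, hv, hw]
          rfl
        have : 0 < ‖u.snd.snd‖ := norm_pos_iff.2 hw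
        rw [hv]
        simp only [norm_zero]
        ring_nf
        positivity
      · have : 0 < ‖u.snd.fst‖ := norm_pos_iff.2 hv
        ring_nf
        positivity
    · have h1 := h.1.2 u.fst hx
      have h2 : 0 ≤ μ * ‖L u.fst - u.snd.snd‖ ^ 2 := by positivity
      have h3 := mul_nonneg (sub_nonneg.2 h.2) (sq_nonneg ‖u.snd.fst‖)
      have h4 := mul_norm_sq_le_of_isPositive hC u.fst
      have h5 : 0 ≤ κ / 2 * (‖A u.fst‖ ^ 2 - μ * ‖B (L u.fst)‖ ^ 2 + μ * ‖B u.snd.fst‖ ^ 2) := by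
        have : 0 ≤ μ * ‖B u.snd.fst‖ ^ 2 := by positivity
        exact mul_nonneg (by linarith) (by linarith)
      linarith [forward_add_le_inner_blockP A L B σ τ hμ hκ u]

end StepSizes

/-- The operator norm bounds the quadratic form, and the slack `κ - 1` in `σ` makes the inequality
strict. -/
theorem stepSize_example {X Y Z Z' : Type*}
    [NormedAddCommGroup X] [InnerProductSpace ℝ X] [CompleteSpace X]
    [NormedAddCommGroup Y] [InnerProductSpace ℝ Y] [CompleteSpace Y]
    [NormedAddCommGroup Z] [InnerProductSpace ℝ Z] [CompleteSpace Z]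
    [NormedAddCommGroup Z'] [InnerProductSpace ℝ Z']
    (A : X →L[ℝ] Y) (L : X →L[ℝ] Z) (B : Z →L[ℝ] Z') (μ : ℝ) {κ : ℝ} (hκ : 1 < κ) :
    StepSize A L B μ
    (‖(κ / 2) • (A.adjoint ∘L A) + μ • (L.adjoint ∘L L)‖ + (κ - 1))
    ((κ / 2 + 2 / κ) * μ * ‖B‖ ^ 2 + (κ - 1)) κ := by
  refine ⟨⟨fun x x' => ?_, fun x hx => ?_⟩, by linarith⟩
  · simp only [ContinuousLinearMap.coe_coe, sub_apply,
      smul_apply, ContinuousLinearMap.comp_apply, inner_sub_right,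
      inner_sub_left, real_inner_smul_right, real_inner_smul_left,
      ContinuousLinearMap.adjoint_inner_right, ContinuousLinearMap.adjoint_inner_left,
      ContinuousLinearMap.id_apply]
  · rw [sub_sub]
    set M := (κ / 2) • (A.adjoint ∘L A) + μ • (L.adjoint ∘L L)
    have h1 : ⟪x, M x⟫_ℝ ≤ ‖M‖ * ‖x‖ ^ 2 := by
      calc ⟪x, M x⟫_ℝ ≤ ‖x‖ * ‖M x‖ := real_inner_le_norm _ _
        _ ≤ ‖x‖ * (‖M‖ * ‖x‖) := by gcongr; exact M.le_opNorm x
        _ = ‖M‖ * ‖x‖ ^ 2 := by ring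
    simp only [sub_apply, smul_apply,
      ContinuousLinearMap.id_apply, inner_sub_right, real_inner_smul_right,
      real_inner_self_eq_norm_sq]
    have : 0 < (κ - 1) * ‖x‖ ^ 2 := by
      have := norm_pos_iff.2 hx
      exact mul_pos (by linarith) (by positivity)
    linarith

theorem triple_inj {X Z : Type*} {x x' : X} {v v' w w' : Z} :
    triple x v w = triple x' v' w' ↔ x = x' ∧ v = v' ∧ w = w' := by
  constructor
  · intro h
    exact ⟨congrArg (fun u : Space X Z => u.fst) h,
      congrArg (fun u : Space X Z => u.snd.fst) h, congrArg (fun u : Space X Z => u.snd.snd) h⟩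
  · rintro ⟨rfl, rfl, rfl⟩
    rfl

/-! ### The iteration operator: fixed points and averagedness. -/

section Operator

variable {X Y Z Z' : Type*}
  [NormedAddCommGroup X] [InnerProductSpace ℝ X] [CompleteSpace X]
  [NormedAddCommGroup Y] [InnerProductSpace ℝ Y] [CompleteSpace Y]
  [NormedAddCommGroup Z] [InnerProductSpace ℝ Z] [CompleteSpace Z]
  [NormedAddCommGroup Z'] [InnerProductSpace ℝ Z'] [CompleteSpace Z']
  {Ψ : Z → ℝ} {A : X →L[ℝ] Y} {L : X →L[ℝ] Z} {B : Z →L[ℝ] Z'} {y : Y} {μ σ τ κ : ℝ}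

/-- The gradient in `x` of the saddle function. -/
def saddleGrad (A : X →L[ℝ] Y) (L : X →L[ℝ] Z) (B : Z →L[ℝ] Z') (y : Y) (μ : ℝ) (x : X)
    (v w : Z) : X :=
  A.adjoint (A x) - A.adjoint y - μ • L.adjoint (B.adjoint (B (L x)))
    + μ • L.adjoint (B.adjoint (B v)) + μ • L.adjoint w

/-- The operator `T` in terms of subgradients. -/
theorem T_eq_iff [ProperSpace Z] (hΨ : ConvexOn ℝ univ Ψ) (hc : Continuous Ψ)
    (hcoer : Tendsto Ψ (Bornology.cobounded Z) atTop) (hμ : 0 < μ) (hσ : 0 < σ) (hτ : 0 < τ)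
    (u p : Space X Z) :
    T Ψ A L B y μ σ τ u = p ↔
      σ • (u.fst - p.fst) = saddleGrad A L B y μ u.fst u.snd.fst u.snd.snd ∧
      IsSubgrad Ψ p.snd.fst ((2 : ℝ) • B.adjoint (B (L p.fst)) - B.adjoint (B (L u.fst))
        + (τ / μ) • (u.snd.fst - p.snd.fst) - B.adjoint (B u.snd.fst)) ∧
      IsSubgrad Ψ ((2 : ℝ) • L p.fst - L u.fst + u.snd.snd - p.snd.snd) p.snd.snd := by
  have hc0 : 0 < μ / τ := div_pos hμ hτ
  obtain ⟨ξ, hξ⟩ : ∃ ξ, ξ = u.fst - (1 / σ) • (A.adjoint (A u.fst)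
      - μ • L.adjoint ((B.adjoint ∘L B) (L u.fst)))
    - (μ / σ) • L.adjoint ((B.adjoint ∘L B) u.snd.fst) - (μ / σ) • L.adjoint u.snd.snd
    + (1 / σ) • A.adjoint y := ⟨_, rfl⟩
  have hT : T Ψ A L B y μ σ τ u = triple ξ
      (prox (fun z => ((μ / τ * Ψ z : ℝ) : EReal))
        ((2 * μ / τ) • (B.adjoint ∘L B) (L ξ) - (μ / τ) • (B.adjoint ∘L B) (L u.fst)
          + (u.snd.fst - (μ / τ) • (B.adjoint ∘L B) u.snd.fst)))
      (prox (conj fun z => (Ψ z : EReal)) ((2 : ℝ) • L ξ - L u.fst + u.snd.snd)) := by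
    rw [hξ]; rfl
  have hξ' : ξ = u.fst - σ⁻¹ • saddleGrad A L B y μ u.fst u.snd.fst u.snd.snd := by
    rw [hξ, saddleGrad]
    simp only [ContinuousLinearMap.comp_apply]
    module
  have hiff : ξ = p.fst ↔
      σ • (u.fst - p.fst) = saddleGrad A L B y μ u.fst u.snd.fst u.snd.snd := by
    rw [hξ', ← eq_inv_smul_iff₀ hσ.ne', sub_eq_iff_eq_add, sub_eq_iff_eq_add, add_comm]
  rw [hT]
  refine (triple_inj (x' := p.fst) (v' := p.snd.fst) (w' := p.snd.snd)).trans ?_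
  rw [hiff]
  refine and_congr_right fun h => ?_
  rw [hiff.2 h]
  refine and_congr ?_ (prox_conj_eq_iff hΨ hc hcoer _ _)
  rw [prox_coe_eq_iff (f := fun z => μ / τ * Ψ z) (hΨ.smul hc0.le) (hc.const_mul _) (hcoer.const_mul_atTop hc0)]
  refine (isSubgrad_smul_iff hc0).trans (iff_of_eq (congrArg _ ?_))
  simp only [ContinuousLinearMap.comp_apply]
  match_scalars <;> field_simp

/-- At a fixed point the extrapolations `2Lξ - Lx` collapse to `Lx`, leaving an optimality system
free of `σ` and `τ`. -/
theorem mem_fixedPoints_T_iff [ProperSpace Z] (hΨ : ConvexOn ℝ univ Ψ) (hc : Continuous Ψ)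
    (hcoer : Tendsto Ψ (Bornology.cobounded Z) atTop) (hμ : 0 < μ) (hσ : 0 < σ) (hτ : 0 < τ)
    (u : Space X Z) :
    u ∈ Function.fixedPoints (T Ψ A L B y μ σ τ) ↔
      saddleGrad A L B y μ u.fst u.snd.fst u.snd.snd = 0 ∧
      IsSubgrad Ψ u.snd.fst (B.adjoint (B (L u.fst - u.snd.fst))) ∧
      IsSubgrad Ψ (L u.fst) u.snd.snd := by
  rw [Function.mem_fixedPoints_iff, T_eq_iff hΨ hc hcoer hμ hσ hτ]
  have e1 : (2 : ℝ) • B.adjoint (B (L u.fst)) - B.adjoint (B (L u.fst))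
      + (τ / μ) • (u.snd.fst - u.snd.fst) - B.adjoint (B u.snd.fst)
      = B.adjoint (B (L u.fst - u.snd.fst)) := by
    rw [map_sub, map_sub]; module
  have e2 : (2 : ℝ) • L u.fst - L u.fst + u.snd.snd - u.snd.snd = L u.fst := by module
  rw [e1, e2, sub_self, smul_zero, eq_comm]

theorem real_inner_saddleGrad_sub (d x x' : X) (v v' w w' : Z) :
    ⟪d, saddleGrad A L B y μ x v w - saddleGrad A L B y μ x' v' w'⟫_ℝ =
      ⟪A d, A (x - x')⟫_ℝ - μ * ⟪B (L d), B (L (x - x'))⟫_ℝ + μ * ⟪B (L d), B (v - v')⟫_ℝ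
        + μ * ⟪L d, w - w'⟫_ℝ := by
  simp only [saddleGrad, inner_sub_right, inner_add_right, real_inner_smul_right,
    ContinuousLinearMap.adjoint_inner_right, map_sub]
  ring

/-- The averagedness inequality of the forward-backward operator `T`. -/
theorem StepSize.inner_T_sub_le [ProperSpace Z] (hΨ : ConvexOn ℝ univ Ψ) (hcont : Continuous Ψ)
    (hcoer : Tendsto Ψ (Bornology.cobounded Z) atTop) (hμ : 0 < μ) (hσ : 0 < σ) (hτ : 0 < τ)
    (hκ : 1 < κ)
    (hC : (A.adjoint ∘L A - μ • (L.adjoint ∘L B.adjoint ∘L B ∘L L)).IsPositive)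
    (h : StepSize A L B μ σ τ κ) (u u' : Space X Z) :
    ⟪T Ψ A L B y μ σ τ u - T Ψ A L B y μ σ τ u',
      blockP L B μ σ τ (T Ψ A L B y μ σ τ u - T Ψ A L B y μ σ τ u')⟫_ℝ + (κ - 1) / κ *
      ⟪(u - u') - (T Ψ A L B y μ σ τ u - T Ψ A L B y μ σ τ u'),
        blockP L B μ σ τ ((u - u') - (T Ψ A L B y μ σ τ u - T Ψ A L B y μ σ τ u'))⟫_ℝ
      ≤ ⟪u - u', blockP L B μ σ τ (u - u')⟫_ℝ := by
  obtain ⟨p, hp⟩ : ∃ p, T Ψ A L B y μ σ τ u = p := ⟨_, rfl⟩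
  obtain ⟨p', hp'⟩ : ∃ p', T Ψ A L B y μ σ τ u' = p' := ⟨_, rfl⟩
  rw [hp, hp']
  obtain ⟨h1, h2, h3⟩ := (T_eq_iff hΨ hcont hcoer hμ hσ hτ u p).1 hp
  obtain ⟨h1', h2', h3'⟩ := (T_eq_iff hΨ hcont hcoer hμ hσ hτ u' p').1 hp'
  obtain ⟨D, hD⟩ : ∃ D, D = p - p' := ⟨_, rfl⟩
  obtain ⟨e, he⟩ : ∃ e, e = (u - u') - D := ⟨_, rfl⟩
  have hd : u - u' = D + e := by rw [he]; abel
  rw [← hD, ← he, hd]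
  have hDx : p.fst - p'.fst = D.fst := by rw [hD]; rfl
  have hDv : p.snd.fst - p'.snd.fst = D.snd.fst := by rw [hD]; rfl
  have hDw : p.snd.snd - p'.snd.snd = D.snd.snd := by rw [hD]; rfl
  have hdx : u.fst - u'.fst = D.fst + e.fst := congrArg (fun u : Space X Z => u.fst) hd
  have hdv : u.snd.fst - u'.snd.fst = D.snd.fst + e.snd.fst :=
    congrArg (fun u : Space X Z => u.snd.fst) hd
  have hdw : u.snd.snd - u'.snd.snd = D.snd.snd + e.snd.snd :=
    congrArg (fun u : Space X Z => u.snd.snd) hd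
  have m1 : σ * ⟪D.fst, e.fst⟫_ℝ = ⟪A D.fst, A (D.fst + e.fst)⟫_ℝ
      - μ * ⟪B (L D.fst), B (L (D.fst + e.fst))⟫_ℝ
      + μ * ⟪B (L D.fst), B (D.snd.fst + e.snd.fst)⟫_ℝ
      + μ * ⟪L D.fst, D.snd.snd + e.snd.snd⟫_ℝ := by
    rw [← hdx, ← hdv, ← hdw, ← real_inner_saddleGrad_sub (y := y), ← h1, ← h1',
      ← smul_sub, real_inner_smul_right]
    congr 3
    rw [sub_sub_sub_comm, hdx, hDx, add_sub_cancel_left]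
  have m2 := h2.monotone h2'
  have e2 : (2 : ℝ) • B.adjoint (B (L p.fst)) - B.adjoint (B (L u.fst))
        + (τ / μ) • (u.snd.fst - p.snd.fst) - B.adjoint (B u.snd.fst)
      - ((2 : ℝ) • B.adjoint (B (L p'.fst)) - B.adjoint (B (L u'.fst))
        + (τ / μ) • (u'.snd.fst - p'.snd.fst) - B.adjoint (B u'.snd.fst))
      = (2 : ℝ) • B.adjoint (B (L (p.fst - p'.fst))) - B.adjoint (B (L (u.fst - u'.fst)))
        + (τ / μ) • ((u.snd.fst - u'.snd.fst) - (p.snd.fst - p'.snd.fst))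
        - B.adjoint (B (u.snd.fst - u'.snd.fst)) := by
    simp only [map_sub]; module
  rw [e2, hDx, hDv, hdx, hdv, add_sub_cancel_left] at m2
  have m3 := h3.monotone h3'
  have e3 : (2 : ℝ) • L p.fst - L u.fst + u.snd.snd - p.snd.snd
      - ((2 : ℝ) • L p'.fst - L u'.fst + u'.snd.snd - p'.snd.snd)
      = (2 : ℝ) • L (p.fst - p'.fst) - L (u.fst - u'.fst)
        + ((u.snd.snd - u'.snd.snd) - (p.snd.snd - p'.snd.snd)) := by
    simp only [map_sub]; module
  rw [e3, hDx, hDw, hdx, hdw, add_sub_cancel_left] at m3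
  -- The forward term pairs `D` with `D + e`; polarization centres it at `D + e/2`, where `Q ≥ 0`,
  -- at the cost of `Q(e)/4`.
  have m4 := mul_norm_sq_le_of_isPositive hC (D.fst + (1 / 2 : ℝ) • e.fst)
  have m5 : 0 ≤ μ * ‖B (D.snd.fst + (1 / 2 : ℝ) • e.snd.fst)‖ ^ 2 := by positivity
  have m6 := h.forward_le hμ hκ e
  have hκ0 : 0 < κ := by linarith
  have m7 : 0 ≤ ⟪e, blockP L B μ σ τ e⟫_ℝ / κ
      - 1 / 2 * (‖A e.fst‖ ^ 2 - μ * ‖B (L e.fst)‖ ^ 2 + μ * ‖B e.snd.fst‖ ^ 2) := by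
    rw [sub_nonneg, le_div_iff₀ hκ0]
    linarith
  have m8 : (κ - 1) / κ * ⟪e, blockP L B μ σ τ e⟫_ℝ
      = ⟪e, blockP L B μ σ τ e⟫_ℝ - ⟪e, blockP L B μ σ τ e⟫_ℝ / κ := by
    field_simp
  have hP := h.posDef_blockP hμ hτ hκ hC
  rw [m8, map_add, inner_add_left, inner_add_right, inner_add_right, hP.inner_symm e D]
  have m9 : ⟪D, blockP L B μ σ τ e⟫_ℝ = _ := inner_blockP D e
  have m2' := mul_nonneg hμ.le m2
  have m3' := mul_nonneg hμ.le m3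
  have hτμ : ∀ r : ℝ, μ * (τ / μ * r) = τ * r := fun r => by field_simp
  simp only [map_add, map_smul, inner_add_left, inner_add_right, inner_sub_left,
    real_inner_smul_left, ContinuousLinearMap.adjoint_inner_left, norm_add_sq_real, norm_smul,
    real_inner_smul_right, mul_pow, mul_add, mul_sub, hτμ] at m1 m2' m3' m4 m5
  simp only [real_inner_self_eq_norm_sq] at m1 m2' m3' m4 m5
  norm_num at m4 m5
  rw [m9]
  simp only [inner_add_right, inner_sub_right, real_inner_smul_right, mul_add, mul_sub] at m3'
  rw [real_inner_comm D.snd.snd (L D.fst)] at m1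
  rw [real_inner_comm (B D.snd.fst) (B (L e.fst)), real_inner_comm D.snd.fst e.snd.fst,
    real_inner_comm (B D.snd.fst) (B e.snd.fst)] at m2'
  linarith

end Operator

/-! ### The penalty as a supremum of continuous functions. -/

section Penalty

variable {Z Z' : Type*}
  [NormedAddCommGroup Z] [InnerProductSpace ℝ Z] [NormedAddCommGroup Z'] [InnerProductSpace ℝ Z']
  {Ψ : Z → ℝ} {B : Z →L[ℝ] Z'}

theorem gme_eq {z v : Z}
    (h : ∀ v', Ψ v + 1 / 2 * ‖B (z - v)‖ ^ 2 ≤ Ψ v' + 1 / 2 * ‖B (z - v')‖ ^ 2) :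
    gme Ψ B z = Ψ z - (Ψ v + 1 / 2 * ‖B (z - v)‖ ^ 2) := by
  rw [gme]
  congr 1
  exact le_antisymm (ciInf_le ⟨_, by rintro _ ⟨v', rfl⟩; exact h v'⟩ v) (le_ciInf h)

theorem le_gme [ProperSpace Z] (hc : Continuous Ψ)
    (hcoer : Tendsto Ψ (Bornology.cobounded Z) atTop) (z v : Z) :
    Ψ z - (Ψ v + 1 / 2 * ‖B (z - v)‖ ^ 2) ≤ gme Ψ B z := by
  obtain ⟨v₀, hv₀⟩ := exists_forall_add_norm_sq_le hc hcoer B z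
  rw [gme_eq hv₀]
  linarith [hv₀ v]

theorem lowerSemicontinuous_norm_sq_add_gme {Y : Type*} [NormedAddCommGroup Y] [ProperSpace Z]
    (hc : Continuous Ψ) (hcoer : Tendsto Ψ (Bornology.cobounded Z) atTop)
    {μ : ℝ} (hμ : 0 < μ) (B : Z →L[ℝ] Z') (y : Y) :
    LowerSemicontinuous fun p : Y × Z => 1 / 2 * ‖y - p.1‖ ^ 2 + μ * gme Ψ B p.2 := by
  intro p c hcp
  -- Freezing `v` at the minimizer for `p.2` gives a continuous minorant that touches the function
  -- at `p`.
  obtain ⟨v, hv⟩ := exists_forall_add_norm_sq_le hc hcoer B p.2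
  have hcont : Continuous fun p : Y × Z =>
      1 / 2 * ‖y - p.1‖ ^ 2 + μ * (Ψ p.2 - (Ψ v + 1 / 2 * ‖B (p.2 - v)‖ ^ 2)) := by fun_prop
  beta_reduce at hcp ⊢
  rw [gme_eq hv] at hcp
  filter_upwards [hcont.continuousAt.eventually_const_lt hcp] with q hq
  exact hq.trans_le (by gcongr; exact le_gme hc hcoer q.2 v)

end Penalty

theorem exists_forall_norm_le_of_le {E : Type*} [NormedAddCommGroup E] {f : E → ℝ}
    (hcoer : Tendsto f (Bornology.cobounded E) atTop) (c : ℝ) :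
    ∃ R, ∀ v, f v ≤ c → ‖v‖ ≤ R := by
  have h : Bornology.IsBounded {v | f v ≤ c} := by
    rw [Bornology.isBounded_def]
    filter_upwards [hcoer.eventually_gt_atTop c] with v hv
    simpa using hv
  obtain ⟨R, hR⟩ := h.exists_norm_le
  exact ⟨R, fun v hv => hR v hv⟩

/-! ### Optimality conditions and existence of minimizers. -/

section Solutions

variable {X Y Z Z' : Type*}
  [NormedAddCommGroup X] [InnerProductSpace ℝ X] [CompleteSpace X]
  [NormedAddCommGroup Y] [InnerProductSpace ℝ Y] [CompleteSpace Y]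
  [NormedAddCommGroup Z] [InnerProductSpace ℝ Z] [CompleteSpace Z]
  [NormedAddCommGroup Z'] [InnerProductSpace ℝ Z'] [CompleteSpace Z']
  {Ψ : Z → ℝ} {A : X →L[ℝ] Y} {L : X →L[ℝ] Z} {B : Z →L[ℝ] Z'} {y : Y} {μ σ τ κ : ℝ}

/-- A saddle gradient is a subgradient of the cost. -/
theorem cost_add_inner_le [ProperSpace Z] (hΨ : ConvexOn ℝ univ Ψ) (hc : Continuous Ψ)
    (hcoer : Tendsto Ψ (Bornology.cobounded Z) atTop) (hμ : 0 < μ)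
    (hC : (A.adjoint ∘L A - μ • (L.adjoint ∘L B.adjoint ∘L B ∘L L)).IsPositive)
    {x : X} {v w : Z} (hv : IsSubgrad Ψ v (B.adjoint (B (L x - v)))) (hw : IsSubgrad Ψ (L x) w)
    (x' : X) :
    cost Ψ A L B y μ x + ⟪saddleGrad A L B y μ x v w, x' - x⟫_ℝ ≤ cost Ψ A L B y μ x' := by
  obtain ⟨δ, rfl⟩ : ∃ δ, x' = x + δ := ⟨x' - x, by abel⟩
  rw [add_sub_cancel_left, cost, cost,
    gme_eq ((forall_add_norm_sq_le_iff_isSubgrad hΨ B (L x) v).2 hv)]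
  -- Keeping `v` fixed bounds the penalty at `x + δ` from below; the remainder `½(‖Aδ‖² - μ‖BLδ‖²)`
  -- is nonnegative by `h3`.
  have h1 := mul_le_mul_of_nonneg_left (le_gme (B := B) hc hcoer (L (x + δ)) v) hμ.le
  have h2 := mul_le_mul_of_nonneg_left (hw (L (x + δ))) hμ.le
  have h3 := mul_norm_sq_le_of_isPositive hC δ
  have h4 := half_norm_sub_sq (y - A x) (A δ)
  have h5 := half_norm_sub_sq (B (L x - v)) (-B (L δ))
  rw [sub_sub, ← map_add] at h4
  rw [sub_neg_eq_add, ← map_add, norm_neg, inner_neg_right, sub_add_eq_add_sub, ← map_add] at h5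
  rw [h5] at h1
  rw [map_add L x δ, add_sub_cancel_left, ← map_add] at h2
  rw [h4]
  simp only [saddleGrad, inner_sub_left, inner_add_left, real_inner_smul_left,
    ContinuousLinearMap.adjoint_inner_left, map_sub] at h1 h2 ⊢
  linarith

theorem mem_solutions_of_saddleGrad_eq_zero [ProperSpace Z] (hΨ : ConvexOn ℝ univ Ψ)
    (hc : Continuous Ψ) (hcoer : Tendsto Ψ (Bornology.cobounded Z) atTop) (hμ : 0 < μ)
    (hC : (A.adjoint ∘L A - μ • (L.adjoint ∘L B.adjoint ∘L B ∘L L)).IsPositive)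
    {x : X} {v w : Z} (hv : IsSubgrad Ψ v (B.adjoint (B (L x - v)))) (hw : IsSubgrad Ψ (L x) w)
    (h : saddleGrad A L B y μ x v w = 0) : x ∈ solutions Ψ A L B y μ := by
  intro x'
  have := cost_add_inner_le (y := y) hΨ hc hcoer hμ hC hv hw x'
  rwa [h, inner_zero_left, add_zero] at this

theorem exists_forall_norm_le_of_isSubgrad_adjoint (hΨ : ConvexOn ℝ univ Ψ)
    (hcoer : Tendsto Ψ (Bornology.cobounded Z) atTop) (B : Z →L[ℝ] Z') (R : ℝ) :
    ∃ M, ∀ z v, ‖z‖ ≤ R → IsSubgrad Ψ v (B.adjoint (B (z - v))) → ‖v‖ ≤ M := by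
  obtain ⟨M, hM⟩ := exists_forall_norm_le_of_le hcoer (Ψ 0 + 1 / 2 * (‖B‖ * R) ^ 2)
  refine ⟨M, fun z v hz hv => hM v ?_⟩
  -- Comparison with the competitor `0` bounds `Ψ v`, and coercivity then bounds `v`.
  have h1 := (forall_add_norm_sq_le_iff_isSubgrad hΨ B z v).2 hv 0
  have h2 : ‖B (z - 0)‖ ≤ ‖B‖ * R := by
    rw [sub_zero]
    exact (B.le_opNorm z).trans (by gcongr)
  have h3 : ‖B (z - 0)‖ ^ 2 ≤ (‖B‖ * R) ^ 2 := by gcongr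
  linarith [sq_nonneg ‖B (z - v)‖]

/-- By Fermat's rule these are the minimizers of a convex function, hence one of its sublevel sets.
-/
theorem convex_setOf_isSubgrad_adjoint [ProperSpace Z] (hΨ : ConvexOn ℝ univ Ψ)
    (hc : Continuous Ψ) (hcoer : Tendsto Ψ (Bornology.cobounded Z) atTop) (B : Z →L[ℝ] Z')
    (z : Z) : Convex ℝ {v | IsSubgrad Ψ v (B.adjoint (B (z - v)))} := by
  have hg : ConvexOn ℝ univ fun v => Ψ v + 1 / 2 * ‖B (z - v)‖ ^ 2 := by
    refine convexOn_of_forall_exists_isSubgrad fun v => ?_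
    obtain ⟨w, hw⟩ := hΨ.exists_isSubgrad hc v
    refine ⟨w - B.adjoint (B (z - v)), fun v' => ?_⟩
    have h1 := hw v'
    have h2 := half_norm_sub_sq (B (z - v)) (B (v' - v))
    rw [← map_sub, sub_sub_sub_cancel_right] at h2
    rw [inner_sub_left, ContinuousLinearMap.adjoint_inner_left]
    linarith [sq_nonneg ‖B (v' - v)‖]
  obtain ⟨v₀, hv₀⟩ := exists_forall_add_norm_sq_le hc hcoer B z
  convert hg.convex_le (Ψ v₀ + 1 / 2 * ‖B (z - v₀)‖ ^ 2) using 1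
  ext v
  simp only [mem_ofPred_eq, mem_univ, true_and, ← forall_add_norm_sq_le_iff_isSubgrad hΨ]
  exact ⟨fun h => h v₀, fun h v' => h.trans (hv₀ v')⟩

/-- At `x + t d` with `t > 0`, every saddle gradient pairs nonnegatively with `d`, since `J` is no
smaller there than at `x`. Boundedness and closed subgradient graphs allow `t → 0`; `v` and `w` may
depend on `d`. -/
theorem exists_isSubgrad_inner_nonneg [ProperSpace Z] (hΨ : ConvexOn ℝ univ Ψ)
    (hc : Continuous Ψ) (hcoer : Tendsto Ψ (Bornology.cobounded Z) atTop) (hμ : 0 < μ)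
    (hC : (A.adjoint ∘L A - μ • (L.adjoint ∘L B.adjoint ∘L B ∘L L)).IsPositive)
    {x : X} (hx : x ∈ solutions Ψ A L B y μ) (d : X) :
    ∃ v w, IsSubgrad Ψ v (B.adjoint (B (L x - v))) ∧ IsSubgrad Ψ (L x) w ∧
      0 ≤ ⟪saddleGrad A L B y μ x v w, d⟫_ℝ := by
  have hex : ∀ z, ∃ v w, IsSubgrad Ψ v (B.adjoint (B (z - v))) ∧ IsSubgrad Ψ z w := by
    intro z
    obtain ⟨v, hv⟩ := exists_forall_add_norm_sq_le hc hcoer B z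
    obtain ⟨w, hw⟩ := hΨ.exists_isSubgrad hc z
    exact ⟨v, w, (forall_add_norm_sq_le_iff_isSubgrad hΨ B z v).1 hv, hw⟩
  choose v w hv hw using hex
  let t : ℕ → ℝ := fun n => 1 / ((n : ℝ) + 1)
  have htpos : ∀ n, 0 < t n := fun n => by positivity
  have ht0 : Tendsto t atTop (𝓝 0) := tendsto_one_div_add_atTop_nhds_zero_nat
  let s : ℕ → X := fun n => x + t n • d
  have hs : Tendsto s atTop (𝓝 x) := by
    simpa using (ht0.smul_const d).const_add x
  have hLs : Tendsto (fun n => L (s n)) atTop (𝓝 (L x)) := (L.continuous.tendsto x).comp hs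
  have hnonneg : ∀ n, 0 ≤ ⟪saddleGrad A L B y μ (s n) (v (L (s n))) (w (L (s n))), d⟫_ℝ := by
    intro n
    have h1 := cost_add_inner_le (y := y) hΨ hc hcoer hμ hC (hv (L (s n))) (hw (L (s n))) x
    have h2 := hx (s n)
    have h3 : x - s n = -(t n • d) := by simp [s]
    rw [h3, inner_neg_right, real_inner_smul_right] at h1
    exact nonneg_of_mul_nonneg_right (by linarith) (htpos n)
  obtain ⟨R, hR⟩ := hLs.norm.bddAbove_range
  obtain ⟨M₁, hM₁⟩ := exists_forall_norm_le_of_isSubgrad_adjoint hΨ hcoer B R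
  obtain ⟨M₂, hM₂⟩ := exists_forall_isSubgrad_norm_le hc R
  have hmem : ∀ n, (v (L (s n)), w (L (s n))) ∈
      Metric.closedBall (0 : Z) M₁ ×ˢ Metric.closedBall (0 : Z) M₂ := fun n =>
    ⟨mem_closedBall_zero_iff.2 (hM₁ _ _ (hR ⟨n, rfl⟩) (hv _)),
      mem_closedBall_zero_iff.2 (hM₂ _ _ (hR ⟨n, rfl⟩) (hw _))⟩
  obtain ⟨⟨v', w'⟩, -, φ, hφ, hlim⟩ :=
    ((isCompact_closedBall _ _).prod (isCompact_closedBall _ _)).tendsto_subseq hmem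
  have hlv : Tendsto (fun n => v (L (s (φ n)))) atTop (𝓝 v') := (continuous_fst.tendsto _).comp hlim
  have hlw : Tendsto (fun n => w (L (s (φ n)))) atTop (𝓝 w') := (continuous_snd.tendsto _).comp hlim
  have hLφ := hLs.comp hφ.tendsto_atTop
  have hcl := isClosed_setOf_isSubgrad Ψ hc
  refine ⟨v', w', ?_, ?_, ?_⟩
  · refine hcl.mem_of_tendsto (x := (v', B.adjoint (B (L x - v')))) (hlv.prodMk_nhds
      (((B.adjoint ∘L B).continuous.tendsto _).comp (hLφ.sub hlv)))
      (Eventually.of_forall fun n => hv (L (s (φ n))))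
  · exact hcl.mem_of_tendsto (x := (L x, w')) (hLφ.prodMk_nhds hlw)
      (Eventually.of_forall fun n => hw (L (s (φ n))))
  · have hcont : Continuous fun p : X × Z × Z => ⟪saddleGrad A L B y μ p.1 p.2.1 p.2.2, d⟫_ℝ := by
      unfold saddleGrad
      fun_prop
    exact ge_of_tendsto ((hcont.tendsto (x, v', w')).comp
      ((hs.comp hφ.tendsto_atTop).prodMk_nhds (hlv.prodMk_nhds hlw)))
      (Eventually.of_forall fun n => hnonneg (φ n))

/-- The first order optimality condition for the cost. -/
theorem exists_saddleGrad_eq_zero [ProperSpace Z] (hΨ : ConvexOn ℝ univ Ψ)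
    (hc : Continuous Ψ) (hcoer : Tendsto Ψ (Bornology.cobounded Z) atTop) (hμ : 0 < μ)
    (hC : (A.adjoint ∘L A - μ • (L.adjoint ∘L B.adjoint ∘L B ∘L L)).IsPositive)
    {x : X} (hx : x ∈ solutions Ψ A L B y μ) :
    ∃ v w, saddleGrad A L B y μ x v w = 0 ∧
      IsSubgrad Ψ v (B.adjoint (B (L x - v))) ∧ IsSubgrad Ψ (L x) w := by
  set V : Set Z := {v | IsSubgrad Ψ v (B.adjoint (B (L x - v)))} with hV
  set W : Set Z := {w | IsSubgrad Ψ (L x) w} with hW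
  -- `S` is the part of the saddle gradient linear in `(v, w)` and `-b` the rest, so the goal is `b
  -- ∈ S '' (V ×ˢ W)`.
  let S : Z × Z →L[ℝ] X := μ • (L.adjoint ∘L B.adjoint ∘L B ∘L ContinuousLinearMap.fst ℝ Z Z)
    + μ • (L.adjoint ∘L ContinuousLinearMap.snd ℝ Z Z)
  obtain ⟨b, hb⟩ : ∃ b, b = A.adjoint y + μ • L.adjoint (B.adjoint (B (L x)))
    - A.adjoint (A x) := ⟨_, rfl⟩
  have hS : ∀ v w, S (v, w) = saddleGrad A L B y μ x v w + b := by
    intro v w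
    simp only [S, saddleGrad, hb, add_apply, smul_apply, ContinuousLinearMap.comp_apply,
      ContinuousLinearMap.coe_fst', ContinuousLinearMap.coe_snd']
    abel
  have hcl := isClosed_setOf_isSubgrad Ψ hc
  obtain ⟨M₁, hM₁⟩ := exists_forall_norm_le_of_isSubgrad_adjoint hΨ hcoer B ‖L x‖
  obtain ⟨M₂, hM₂⟩ := exists_forall_isSubgrad_norm_le hc ‖L x‖
  have hVc : IsCompact V := (isCompact_closedBall (0 : Z) M₁).of_isClosed_subset
    (hcl.preimage (f := fun v => (v, B.adjoint (B (L x - v)))) (by fun_prop))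
    fun v hv => mem_closedBall_zero_iff.2 (hM₁ _ v le_rfl hv)
  have hWc : IsCompact W := (isCompact_closedBall (0 : Z) M₂).of_isClosed_subset
    (hcl.preimage (f := fun w => (L x, w)) (by fun_prop))
    fun w hw => mem_closedBall_zero_iff.2 (hM₂ _ w le_rfl hw)
  have hKc : IsCompact (S '' (V ×ˢ W)) := (hVc.prod hWc).image S.continuous
  have hKconv : Convex ℝ (S '' (V ×ˢ W)) :=
    ((convex_setOf_isSubgrad_adjoint hΨ hc hcoer B (L x)).prod
      (convex_setOf_isSubgrad Ψ (L x))).linear_image (S : Z × Z →ₗ[ℝ] X)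
  have hKne : (S '' (V ×ˢ W)).Nonempty := by
    obtain ⟨v, w, hv, hw, -⟩ := exists_isSubgrad_inner_nonneg hΨ hc hcoer hμ hC hx 0
    exact ⟨_, mem_image_of_mem S (mk_mem_prod hv hw)⟩
  obtain ⟨k, hk, hkmin⟩ := exists_norm_eq_iInf_of_complete_convex hKne hKc.isComplete hKconv b
  have hproj := (norm_eq_iInf_iff_real_inner_le_zero hKconv hk).1 hkmin
  -- For the projection `k` of `b`, testing the direction `b - k` against the projection inequality
  -- forces `‖b - k‖² ≤ 0`.
  obtain ⟨v, w, hv, hw, hvw⟩ := exists_isSubgrad_inner_nonneg hΨ hc hcoer hμ hC hx (b - k)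
  have h1 := hproj _ (mem_image_of_mem S (mk_mem_prod hv hw))
  rw [hS, show saddleGrad A L B y μ x v w + b - k = saddleGrad A L B y μ x v w + (b - k) by abel,
    inner_add_right, real_inner_comm, real_inner_self_eq_norm_sq] at h1
  have h2 : ‖b - k‖ = 0 := by nlinarith [norm_nonneg (b - k)]
  obtain ⟨⟨v', w'⟩, ⟨hv', hw'⟩, rfl⟩ := hk
  refine ⟨v', w', ?_, hv', hw'⟩
  rw [norm_eq_zero, hS] at h2
  simpa using h2

theorem solutions_eq_image_fixedPoints [ProperSpace Z] (hΨ : ConvexOn ℝ univ Ψ)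
    (hc : Continuous Ψ) (hcoer : Tendsto Ψ (Bornology.cobounded Z) atTop) (hμ : 0 < μ)
    (hσ : 0 < σ) (hτ : 0 < τ)
    (hC : (A.adjoint ∘L A - μ • (L.adjoint ∘L B.adjoint ∘L B ∘L L)).IsPositive) :
    solutions Ψ A L B y μ =
      (fun u : Space X Z => u.fst) '' Function.fixedPoints (T Ψ A L B y μ σ τ) := by
  ext x
  constructor
  · intro hx
    obtain ⟨v, w, h⟩ := exists_saddleGrad_eq_zero hΨ hc hcoer hμ hC hx
    exact ⟨triple x v w, (mem_fixedPoints_T_iff hΨ hc hcoer hμ hσ hτ _).2 h, rfl⟩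
  · rintro ⟨u, hu, rfl⟩
    obtain ⟨h1, h2, h3⟩ := (mem_fixedPoints_T_iff hΨ hc hcoer hμ hσ hτ u).1 hu
    exact mem_solutions_of_saddleGrad_eq_zero hΨ hc hcoer hμ hC h2 h3 h1

/-- `J` is constant along the common kernel of `A` and `L`, so compactness is sought in the range of
`(A, L)`. On a sublevel set `Ax` is bounded, hence `BLx` by `hC`, hence `Ψ(Lx)` by testing the
penalty with `v = 0`, hence `Lx` by coercivity. -/
theorem solutions_nonempty [FiniteDimensional ℝ X] [FiniteDimensional ℝ Y]
    [FiniteDimensional ℝ Z] (hc : Continuous Ψ)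
    (hcoer : Tendsto Ψ (Bornology.cobounded Z) atTop) (hμ : 0 < μ)
    (hC : (A.adjoint ∘L A - μ • (L.adjoint ∘L B.adjoint ∘L B ∘L L)).IsPositive) :
    (solutions Ψ A L B y μ).Nonempty := by
  let j : Y × Z → ℝ := fun p => 1 / 2 * ‖y - p.1‖ ^ 2 + μ * gme Ψ B p.2
  have hj : LowerSemicontinuous j := lowerSemicontinuous_norm_sq_add_gme hc hcoer hμ B y
  let R : Submodule ℝ (Y × Z) := (A.prod L : X →ₗ[ℝ] Y × Z).range
  let K : Set (Y × Z) := R ∩ {p | j p ≤ j 0}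
  have hKclosed : IsClosed K :=
    R.closed_of_finiteDimensional.inter (hj.isClosed_preimage (j 0))
  obtain ⟨N, hN⟩ := exists_forall_norm_le_of_le hcoer
    (j 0 / μ + Ψ 0 + 1 / 2 * ((‖y‖ + √(2 * j 0)) ^ 2 / μ))
  have hKsub : K ⊆ Metric.closedBall (0 : Y) (‖y‖ + √(2 * j 0)) ×ˢ Metric.closedBall (0 : Z) N := by
    rintro _ ⟨⟨x, rfl⟩, hx⟩
    change 1 / 2 * ‖y - A x‖ ^ 2 + μ * gme Ψ B (L x) ≤ j 0 at hx
    have h0 : 0 ≤ gme Ψ B (L x) := by simpa using le_gme (B := B) hc hcoer (L x) (L x)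
    have h1 := mul_nonneg hμ.le h0
    have h2 : ‖y - A x‖ ≤ √(2 * j 0) := Real.le_sqrt_of_sq_le (by linarith)
    have h3 : ‖A x‖ ≤ ‖y‖ + √(2 * j 0) := by
      have := norm_sub_le y (y - A x)
      rw [sub_sub_cancel] at this
      linarith
    refine ⟨mem_closedBall_zero_iff.2 h3, mem_closedBall_zero_iff.2 (hN _ ?_)⟩
    change Ψ (L x) ≤ _
    have h4 := le_gme (B := B) hc hcoer (L x) 0
    rw [sub_zero] at h4
    have h5 : ‖B (L x)‖ ^ 2 ≤ (‖y‖ + √(2 * j 0)) ^ 2 / μ := by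
      rw [le_div_iff₀ hμ, mul_comm]
      exact (mul_norm_sq_le_of_isPositive hC x).trans (by gcongr)
    have h6 : gme Ψ B (L x) ≤ j 0 / μ := by
      rw [le_div_iff₀ hμ, mul_comm]
      linarith [sq_nonneg ‖y - A x‖]
    linarith
  have hKc : IsCompact K :=
    ((isCompact_closedBall _ _).prod (isCompact_closedBall _ _)).of_isClosed_subset hKclosed hKsub
  obtain ⟨_, ⟨⟨x, rfl⟩, hx⟩, hmin⟩ := (hj.lowerSemicontinuousOn K).exists_isMinOn
    (⟨0, R.zero_mem, le_refl (j 0)⟩ : K.Nonempty) hKc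
  refine ⟨x, fun x' => ?_⟩
  change j (A x, L x) ≤ j (A x', L x')
  by_cases h : j (A x', L x') ≤ j 0
  · exact hmin ⟨⟨x', rfl⟩, h⟩
  · exact le_trans hx (le_of_not_ge h)

end Solutions

end LiGME

end

theorem theorem1 {X Y Z Z' : Type*}
    [NormedAddCommGroup X] [InnerProductSpace ℝ X] [CompleteSpace X] [FiniteDimensional ℝ X]
    [NormedAddCommGroup Y] [InnerProductSpace ℝ Y] [CompleteSpace Y] [FiniteDimensional ℝ Y]
    [NormedAddCommGroup Z] [InnerProductSpace ℝ Z] [CompleteSpace Z] [FiniteDimensional ℝ Z]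
    [NormedAddCommGroup Z'] [InnerProductSpace ℝ Z'] [CompleteSpace Z'] [FiniteDimensional ℝ Z']
    (Ψ : Z → ℝ) (hΨ_conv : ConvexOn ℝ univ Ψ) (hΨ_lsc : LowerSemicontinuous Ψ)
    (hΨ_coer : Tendsto Ψ (Bornology.cobounded Z) atTop) (hΨ_even : ∀ z, Ψ (-z) = Ψ z)
    (A : X →L[ℝ] Y) (L : X →L[ℝ] Z) (B : Z →L[ℝ] Z') (y : Y) (μ : ℝ) (hμ : 0 < μ)
    (hC : (A.adjoint ∘L A - μ • (L.adjoint ∘L B.adjoint ∘L B ∘L L)).IsPositive)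
    (σ τ : ℝ) (hσ : 0 < σ) (hτ : 0 < τ) :
    -- the minimum in the penalty is attained and both proximity operators are well defined
    ((∀ z : Z, ∃ v : Z, IsMinOn (fun v' => Ψ v' + 1 / 2 * ‖B (z - v')‖ ^ 2) univ v) ∧
      (∀ z : Z, ∃! p : Z, LiGME.IsProx (fun z' => ((μ / τ * Ψ z' : ℝ) : EReal)) z p) ∧
      (∀ z : Z, ∃! p : Z, LiGME.IsProx (LiGME.conj fun z' => (Ψ z' : EReal)) z p)) ∧
    -- the step-size condition can be satisfied for every `κ > 1`
    (∀ κ : ℝ, 1 < κ → LiGME.StepSize A L B μ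
      (‖(κ / 2) • (A.adjoint ∘L A) + μ • (L.adjoint ∘L L)‖ + (κ - 1))
      ((κ / 2 + 2 / κ) * μ * ‖B‖ ^ 2 + (κ - 1)) κ) ∧
    -- (a)
    LiGME.solutions Ψ A L B y μ =
      (fun u : LiGME.Space X Z => u.fst) '' Function.fixedPoints (LiGME.T Ψ A L B y μ σ τ) ∧
    ∀ κ : ℝ, 1 < κ → LiGME.StepSize A L B μ σ τ κ →
      -- (b)
      (LiGME.PosDef (LiGME.blockP L B μ σ τ) ∧
        LiGME.AveragedIn (LiGME.blockP L B μ σ τ) (κ / (2 * κ - 1)) (LiGME.T Ψ A L B y μ σ τ)) ∧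
      -- (c)
      ∀ u : ℕ → LiGME.Space X Z, (∀ k, u (k + 1) = LiGME.T Ψ A L B y μ σ τ (u k)) →
        ∃ uStar ∈ Function.fixedPoints (LiGME.T Ψ A L B y μ σ τ),
          Tendsto u atTop (𝓝 uStar) ∧
          Tendsto (fun k => (u k).fst) atTop (𝓝 uStar.fst) ∧
          uStar.fst ∈ LiGME.solutions Ψ A L B y μ := by
  have hc : Continuous Ψ := hΨ_conv.locallyLipschitz.continuous
  have hfix := LiGME.solutions_eq_image_fixedPoints (σ := σ) (τ := τ) (y := y)
    hΨ_conv hc hΨ_coer hμ hσ hτ hC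
  refine ⟨⟨fun z => ?_, fun z => ?_, fun z => ?_⟩, fun κ hκ => LiGME.stepSize_example A L B μ hκ,
    hfix, fun κ hκ hstep => ?_⟩
  · obtain ⟨v, hv⟩ := LiGME.exists_forall_add_norm_sq_le hc hΨ_coer B z
    exact ⟨v, fun v' _ => hv v'⟩
  · have hpos : 0 < μ / τ := div_pos hμ hτ
    have hconv : ConvexOn ℝ univ fun z => μ / τ * Ψ z := hΨ_conv.smul hpos.le
    obtain ⟨p, hp⟩ := LiGME.exists_isProx_coe (hc.const_mul (μ / τ))
      (hΨ_coer.const_mul_atTop hpos) z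
    exact ⟨p, hp, fun q hq => LiGME.isProx_coe_unique hconv hq hp⟩
  · obtain ⟨w, hw⟩ := LiGME.exists_isSubgrad_sub_self hΨ_conv hc hΨ_coer z
    exact ⟨w, hw.isProx_conj, fun w' hw' => hw.isProx_conj_unique hw'⟩
  · have hP := hstep.posDef_blockP hμ hτ hκ hC
    have hT := hstep.inner_T_sub_le (y := y) hΨ_conv hc hΨ_coer hμ hσ hτ hκ hC
    have hκ0 : 0 < κ := one_pos.trans hκ
    have hden : 0 < 2 * κ - 1 := by linarith
    refine ⟨⟨hP, LiGME.averagedIn_of_inner_le hP ⟨div_pos hκ0 hden, ?_⟩ ?_⟩, fun u hu => ?_⟩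
    · rw [div_lt_one hden]
      linarith
    -- The averagedness constant `α` is the one with `(1 - α)/α = 1 - 1/κ`, the factor in
    -- `inner_T_sub_le`.
    · have e : (1 - κ / (2 * κ - 1)) / (κ / (2 * κ - 1)) = (κ - 1) / κ := by
        rw [one_sub_div hden.ne', div_div_div_cancel_right₀ hden.ne']
        ring
      rwa [e]
    · have hne : (Function.fixedPoints (LiGME.T Ψ A L B y μ σ τ)).Nonempty := by
        rw [← image_nonempty, ← hfix]
        exact LiGME.solutions_nonempty hc hΨ_coer hμ hC
      obtain ⟨p, hp, hlim⟩ := LiGME.exists_tendsto_fixedPoint hP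
        (div_pos (sub_pos.2 hκ) hκ0) hT hne u hu
      refine ⟨p, hp, hlim, ?_, ?_⟩
      · exact ((WithLp.prod_continuous_ofLp 2 X (WithLp 2 (Z × Z))).fst.tendsto p).comp hlim
      · rw [hfix]
        exact mem_image_of_mem _ hp
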